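/- **Setting.** Logarithms $\log$ are in base $2$. A source on the alphabet $\mathbb{N}_+=\{1,2,\dots\}$ is a probability distribution $P$ on the set $\mathbb{N}_+^{\mathbb{N}}$ of infinite sequences (with the product $\sigma$-algebra), and $P^n$ is the law of its first $n$ symbols. For probability distributions $P,Q$ on a countable set, $D(P,Q)=\sum_x P(x)\log\frac{P(x)}{Q(x)}\in[0,\infty]$ is the relative entropy. For $f:\mathbb{N}_+\to[0,1]$, the envelope class $\Lambda_f$ is the set of all stationary memoryless sources $P$ on $\mathbb{N}_+$ (with $P^n$ of finite Shannon entropy for all $n$) such that $P^1\{x\}\le f(x)$ for every $x\in\mathbb{N}_+$. The minimax redundancy of $\Lambda_f$ on words of length $n$ is $$R^+(\Lambda_f^n)=\inf_{Q^n}\ \sup_{P\in\Lambda_f} D(P^n,Q^n),$$ where $Q^n$ runs over all probability distributions on $\mathbb{N}_+^n$. **Theorem.** Let $f:\mathbb{N}_+\to[0,1]$ be non-increasing and summable, and put $c(p)=\sum_{k=1}^p f(2k)$ for $p\in\mathbb{N}_+$. Let $p\in\mathbb{N}_+$ be such that $c(p)>1$ and $f(2p)>0$. Let $n\in\mathbb{N}_+$,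 $\epsilon>0$ and $\lambda\in(0,1)$ be such that $$n>\frac{c(p)}{f(2p)}\,\frac{10}{\epsilon(1-\lambda)}.$$ Then $$R^+(\Lambda_f^n)\ \ge\ C(p,n,\lambda,\epsilon)\sum_{i=1}^p\left(\frac12\log\frac{n(1-\lambda)\pi f(2i)}{2c(p)e}-\epsilon\right),$$ where $$C(p,n,\lambda,\epsilon)=\frac{1}{1+\frac{c(p)}{\lambda^2 n f(2p)}}\left(1-\frac{4}{\pi}\sqrt{\frac{5\,c(p)}{(1-\lambda)\,\epsilon\, n f(2p)}}\right).$$ -/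

import Mathlib

open MeasureTheory ProbabilityTheory
open scoped ENNReal

noncomputable section

/-- The alphabet of positive integers carries the σ-algebra of all its subsets. -/
instance : MeasurableSpace ℕ+ := ⊤

instance : DiscreteMeasurableSpace ℕ+ := ⟨fun _ => trivial⟩

variable {α : Type*} [MeasurableSpace α]

/-- A source on the alphabet `α`: a probability distribution on the infinite sequences of
symbols, with the product σ-algebra. -/
abbrev Source (α : Type*) [MeasurableSpace α] : Type _ := ProbabilityMeasure (ℕ → α)

/-- The law `P ^ n` of the first `n` symbols emitted by the source `P`. -/
def Source.block (P : Source α) (n : ℕ) : ProbabilityMeasure (Fin n → α) :=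
  P.map (f := fun x i => x (i : ℕ)) (Measurable.aemeasurable (by fun_prop))

/-- The first marginal `P ^ 1` of a source, as a measure on the alphabet. -/
def Source.marginal (P : Source α) : Measure α :=
  (P : Measure (ℕ → α)).map (fun x => x 0)

/-- The law of the sequence of symbols is invariant under the shift. -/
def Source.IsStationary (P : Source α) : Prop :=
  MeasurePreserving (fun (x : ℕ → α) (k : ℕ) => x (k + 1)) (P : Measure (ℕ → α)) P

/-- The successive symbols are independent. -/
def Source.IsMemoryless (P : Source α) : Prop :=
  iIndepFun (fun (k : ℕ) (x : ℕ → α) => x k) (P : Measure (ℕ → α))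

/-- For every `n`, the Shannon entropy `∑ₓ -Pⁿ{x} log Pⁿ{x}` of the first `n` symbols is finite.
The terms are nonnegative, so finiteness is summability, in any base of logarithms. -/
def Source.HasFiniteEntropy (P : Source α) : Prop :=
  ∀ n : ℕ, Summable fun x : Fin n → α =>
    Real.negMulLog ((P.block n : Measure (Fin n → α)).real {x})

/-- Relative entropy `D(P, Q)` in bits (logarithms in base two). -/
def klDivBits {β : Type*} [MeasurableSpace β] (P Q : ProbabilityMeasure β) : ℝ≥0∞ :=
  InformationTheory.klDiv (P : Measure β) (Q : Measure β) / ENNReal.ofReal (Real.log 2)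

/-- Maximal redundancy of the coding distribution `Q` on words of length `n` with respect to the
class of sources `Λ`, in bits. -/
def maxRedundancy (Λ : Set (Source α)) (n : ℕ) (Q : ProbabilityMeasure (Fin n → α)) : ℝ≥0∞ :=
  ⨆ P ∈ Λ, klDivBits (P.block n) Q

/-- Minimax redundancy of the class of sources `Λ` on words of length `n`, in bits. -/
def minimaxRedundancy (Λ : Set (Source α)) (n : ℕ) : ℝ≥0∞ :=
  ⨅ Q : ProbabilityMeasure (Fin n → α), maxRedundancy Λ n Q

/-- The envelope class of `f`: the stationary memoryless sources on the positive integers (of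
finite entropy) whose first marginal is dominated by `f`. -/
def envelopeClass (f : ℕ+ → ℝ) : Set (Source ℕ+) :=
  {P | P.IsStationary ∧ P.IsMemoryless ∧ P.HasFiniteEntropy ∧
    ∀ x : ℕ+, P.marginal.real {x} ≤ f x}

/-- `c(p) = ∑_{k=1}^p f(2k)`. -/
def evenSum (f : ℕ+ → ℝ) (p : ℕ+) : ℝ :=
  ∑ k ∈ Finset.Icc 1 p, f (2 * k)

end

/-! The maximal redundancy of any coding law `Q` is at least its average over a prior on the class.
The prior used: the letters `2 * i` and `2 * i - 1` form the pair `i`, the pair has the fixed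
probability `q i = f (2 * i) / c`, and a coin with faces `sin² φ i`, `cos² φ i`, the angles `φ i`
independent and uniform, selects the letter. As `c > 1` and `f` is non-increasing, all these sources
lie under the envelope.

The uniform angle is the Jeffreys prior, so the mixture of the coins is a product of
Krichevsky–Trofimov weights over the pairs (`integral_wordCoin`). In nats, the averaged redundancy
is at least the sum over the pairs of the mean of `-log (ktWeight k m)`, minus `n * (2 * log 2 -
1)`, where `2 * log 2 - 1` is the mean entropy of a coin (`exists_coins_sum_ge`).

For a pair seen `N = k + m` times, `neg_log_ktWeight_ge` gives `N * (2 * log 2 - 1)`, plus half the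
positive part of `log (π * N / (2 * e))`, plus a remainder `scoreDeviation`. The remainder has mean
exactly zero (`mixtureMean_scoreDeviation`), and the linear terms cancel the coin entropy. Finally
`N` is binomial with mean `n * q i`, and the one-sided Chebyshev inequality `mixtureMean_posLog_ge`
replaces it by `(1 - λ) * n * q i`. The terms in `ε` only weaken the resulting bound. -/

section Auxiliary

open Filter Topology Finset

/-! ### Krichevsky–Trofimov weights and Stirling-type estimates. -/

/-- The product `∏_{j < k} (j + 1/2)`, that is `Γ(k + 1/2) / Γ(1/2)`. -/
noncomputable def halfRising (k : ℕ) : ℝ := ∏ j ∈ range k, ((j : ℝ) + 1 / 2)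

/-- The sum `∑_{j < k} 2 / (2 j + 1)`. -/
noncomputable def oddHarmonic (k : ℕ) : ℝ := ∑ j ∈ range k, 2 / (2 * (j : ℝ) + 1)

/-- The Krichevsky–Trofimov probability of a binary word with `k` ones and `m` zeros. -/
noncomputable def ktWeight (k m : ℕ) : ℝ := halfRising k * halfRising m / (k + m).factorial

theorem halfRising_succ (k : ℕ) : halfRising (k + 1) = halfRising k * (k + 1 / 2) := by
  rw [halfRising, prod_range_succ, halfRising]

theorem oddHarmonic_succ (k : ℕ) : oddHarmonic (k + 1) = oddHarmonic k + 2 / (2 * k + 1) := by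
  rw [oddHarmonic, sum_range_succ, oddHarmonic]

@[simp] theorem halfRising_zero : halfRising 0 = 1 := by simp [halfRising]

@[simp] theorem oddHarmonic_zero : oddHarmonic 0 = 0 := by simp [oddHarmonic]

theorem halfRising_pos (k : ℕ) : 0 < halfRising k := prod_pos fun _ _ => by positivity

theorem ktWeight_pos (k m : ℕ) : 0 < ktWeight k m := by
  have := halfRising_pos k
  have := halfRising_pos m
  unfold ktWeight; positivity

theorem ktWeight_comm (k m : ℕ) : ktWeight k m = ktWeight m k := by
  rw [ktWeight, ktWeight, mul_comm, add_comm]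

theorem ktWeight_succ_left (k m : ℕ) :
    ktWeight (k + 1) m = ktWeight k m * ((k + 1 / 2) / (k + m + 1)) := by
  rw [ktWeight, ktWeight, halfRising_succ, show k + 1 + m = (k + m) + 1 by ring,
    Nat.factorial_succ]
  push_cast
  have : ((k + m).factorial : ℝ) ≠ 0 := by positivity
  field_simp

theorem ktWeight_succ_right (k m : ℕ) :
    ktWeight k (m + 1) = ktWeight k m * ((m + 1 / 2) / (k + m + 1)) := by
  rw [ktWeight_comm, ktWeight_succ_left, ktWeight_comm, add_comm (m : ℝ) k]

theorem halfRising_mul (k : ℕ) : halfRising k * (4 ^ k * k.factorial) = (2 * k).factorial := by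
  induction k with
  | zero => simp
  | succ k ih =>
    rw [halfRising_succ, show 2 * (k + 1) = 2 * k + 1 + 1 by ring, Nat.factorial_succ,
      Nat.factorial_succ, Nat.factorial_succ]
    push_cast
    rw [← ih]; ring

/-- By `halfRising_mul` this is a ratio of factorials, and Stirling's sequence decreases from index
`k` to `2 * k`. -/
theorem log_halfRising_le (k : ℕ) :
    Real.log (halfRising k) ≤ k * Real.log k - k + Real.log 2 / 2 := by
  rcases k.eq_zero_or_pos with rfl | hk
  · simp; positivity
  have hk' : (0 : ℝ) < k := by exact_mod_cast hk
  have h1 : Real.log (Stirling.stirlingSeq (2 * k)) ≤ Real.log (Stirling.stirlingSeq k) := by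
    have := Stirling.log_stirlingSeq'_antitone (show k - 1 ≤ 2 * k - 1 by omega)
    simpa [Nat.sub_add_cancel hk, Nat.sub_add_cancel (show 1 ≤ 2 * k by omega)] using this
  rw [Stirling.log_stirlingSeq_formula, Stirling.log_stirlingSeq_formula,
    Real.log_div (by positivity) (by positivity), Real.log_div (by positivity) (by positivity),
    Real.log_exp, ← halfRising_mul, Real.log_mul (halfRising_pos k).ne' (by positivity),
    Real.log_mul (by positivity) (by positivity), Real.log_pow,
    show (4 : ℝ) = 2 ^ 2 by norm_num, Real.log_pow] at h1
  push_cast at h1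
  rw [Real.log_mul (x := 2) (y := 2 * (k : ℝ)) (by positivity) (by positivity),
    Real.log_mul (by positivity) hk'.ne'] at h1
  linarith

/-- The left side is the first term of a positive series for `log (1 + 1 / a)`, with `a = k + 1`. -/
theorem two_div_le_log (k : ℕ) :
    2 / (2 * ((k + 1 : ℕ) : ℝ) + 1) ≤ Real.log ((k + 1 + 1 : ℕ) : ℝ) - Real.log ((k + 1 : ℕ) : ℝ) := by
  have hk : (0 : ℝ) < ((k + 1 : ℕ) : ℝ) := by positivity
  have h := Real.hasSum_log_one_add_inv hk
  rw [← Real.log_div (by positivity) (by positivity)]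
  have h2 := h.tsum_eq ▸ h.summable.le_tsum 0 (fun i _ => by positivity)
  refine le_trans (le_of_eq ?_) (h2.trans (le_of_eq ?_))
  · simp; ring
  · congr 1; push_cast; field_simp

theorem oddHarmonic_eq (k : ℕ) :
    oddHarmonic k = 2 * (harmonic (2 * k) : ℝ) - harmonic k := by
  induction k with
  | zero => simp
  | succ k ih =>
    rw [oddHarmonic_succ, show 2 * (k + 1) = 2 * k + 1 + 1 by ring, harmonic_succ, harmonic_succ,
      harmonic_succ, ih]
    push_cast
    field_simp
    ring

/-- The difference `oddHarmonic k - log k` decreases, and its limit follows from `oddHarmonic_eq`.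
-/
theorem log_add_le_oddHarmonic {k : ℕ} (hk : k ≠ 0) :
    Real.log k + 2 * Real.log 2 + Real.eulerMascheroniConstant ≤ oddHarmonic k := by
  obtain ⟨k, rfl⟩ := Nat.exists_eq_succ_of_ne_zero hk
  set g : ℕ → ℝ := fun k => oddHarmonic (k + 1) - Real.log ((k + 1 : ℕ) : ℝ) with hg
  have hanti : Antitone g := antitone_nat_of_succ_le fun k => by
    have := two_div_le_log k
    simp only [hg]
    rw [oddHarmonic_succ (k + 1)]
    linarith
  have hlim : Tendsto g atTop (𝓝 (2 * Real.eulerMascheroniConstant -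
      Real.eulerMascheroniConstant + 2 * Real.log 2)) := by
    have h1 := Real.tendsto_harmonic_sub_log
    have h2 := (h1.comp (tendsto_id.const_mul_atTop' (show 0 < 2 by norm_num))).const_mul 2
    have h3 := ((h2.sub h1).add_const (2 * Real.log 2)).comp (tendsto_add_atTop_nat 1)
    refine h3.congr fun n => ?_
    simp only [hg, Function.comp, id, oddHarmonic_eq]
    rw [Nat.cast_mul, Real.log_mul (by norm_num) (by positivity)]
    push_cast
    ring
  have := hanti.le_of_tendsto hlim k
  simp only [hg] at this
  simp only [Nat.succ_eq_add_one]
  linarith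

/-- The trapezoidal rule overestimates the integral of the convex function `1 / x`; in closed form,
`log x ≤ (x - 1 / x) / 2` for `x ≥ 1`. -/
theorem log_succ_sub_log_le (k : ℕ) :
    Real.log ((k + 1 + 1 : ℕ) : ℝ) - Real.log ((k + 1 : ℕ) : ℝ)
      ≤ (1 / ((k + 1 : ℕ) : ℝ) + 1 / ((k + 1 + 1 : ℕ) : ℝ)) / 2 := by
  have hk : (0 : ℝ) < ((k + 1 : ℕ) : ℝ) := by positivity
  have key : ∀ x : ℝ, 1 ≤ x → Real.log x ≤ (x - 1 / x) / 2 := by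
    intro x hx
    have hm : MonotoneOn (fun x : ℝ => (x - 1 / x) / 2 - Real.log x) (Set.Ici 1) := by
      refine monotoneOn_of_deriv_nonneg (convex_Ici 1) ?_ ?_ ?_
      · refine ContinuousOn.sub (ContinuousOn.div_const (continuousOn_id.sub
          (continuousOn_const.div continuousOn_id ?_)) _) (Real.continuousOn_log.mono ?_) <;>
        · intro y hy; simp at hy ⊢; linarith
      · intro y hy
        simp at hy
        have : y ≠ 0 := by linarith
        have hd : DifferentiableAt ℝ (fun x : ℝ => (x - 1 / x) / 2 - Real.log x) y := by
          fun_prop (disch := assumption)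
        exact hd.differentiableWithinAt
      · intro y hy
        simp at hy
        have hy0 : y ≠ 0 := by linarith
        have h1 : HasDerivAt (fun x : ℝ => (x - 1 / x) / 2 - Real.log x)
            ((1 - (-(y ^ 2)⁻¹)) / 2 - y⁻¹) y := by
          have := (((hasDerivAt_id y).sub (hasDerivAt_inv hy0)).div_const 2).sub
            (Real.hasDerivAt_log hy0)
          refine this.congr_of_eventuallyEq (Eventually.of_forall fun x => ?_)
          simp
        rw [h1.deriv, show (1 - (-(y ^ 2)⁻¹)) / 2 - y⁻¹ = (1 - y⁻¹) ^ 2 / 2 by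
          field_simp; ring]
        positivity
    have := hm (Set.self_mem_Ici) hx hx
    norm_num at this
    simpa [one_div] using this
  rw [← Real.log_div (by positivity) (by positivity)]
  refine (key _ ?_).trans (le_of_eq ?_)
  · rw [one_le_div hk]; push_cast; linarith
  · push_cast; field_simp; ring

/-- By the trapezoidal bound, `harmonic k - log k - 1 / (2 * k)` increases to Euler's constant. -/
theorem harmonic_le_log_add {k : ℕ} (hk : k ≠ 0) :
    (harmonic k : ℝ) ≤ Real.log k + Real.eulerMascheroniConstant + 1 / (2 * k) := by
  obtain ⟨k, rfl⟩ := Nat.exists_eq_succ_of_ne_zero hk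
  set g : ℕ → ℝ := fun k => (harmonic (k + 1) : ℝ) - Real.log ((k + 1 : ℕ) : ℝ)
    - (1 / 2) * (1 / ((k : ℝ) + 1)) with hg
  have hmono : Monotone g := monotone_nat_of_le_succ fun k => by
    have := log_succ_sub_log_le k
    simp only [hg]
    rw [harmonic_succ (k + 1)]
    push_cast at this ⊢
    simp only [one_div] at this ⊢
    linarith
  have hlim : Tendsto g atTop (𝓝 (Real.eulerMascheroniConstant - (1 / 2) * 0)) := by
    have h1 := Real.tendsto_harmonic_sub_log.comp (tendsto_add_atTop_nat 1)
    exact h1.sub (tendsto_one_div_add_atTop_nhds_zero_nat.const_mul _)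
  have := hmono.ge_of_tendsto hlim k
  simp only [hg] at this
  simp only [Nat.succ_eq_add_one]
  push_cast at this ⊢
  have e : 1 / 2 * (1 / ((k : ℝ) + 1)) = 1 / (2 * ((k : ℝ) + 1)) := by field_simp
  linarith

/-- The deviation of the logarithmic score, of mean zero under the Krichevsky–Trofimov mixture. -/
noncomputable def scoreDeviation (k m : ℕ) : ℝ :=
  (k + m) * (1 + (harmonic (k + m) : ℝ)) - k * oddHarmonic k - m * oddHarmonic m

theorem mul_oddHarmonic_ge (k : ℕ) :
    k * Real.log k + k * (2 * Real.log 2 + Real.eulerMascheroniConstant) ≤ k * oddHarmonic k := by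
  rcases eq_or_ne k 0 with rfl | hk
  · simp
  have := mul_le_mul_of_nonneg_left (log_add_le_oddHarmonic hk) (Nat.cast_nonneg (α := ℝ) k)
  linarith

/-- The terms `k * log k`, `m * log m` and Euler's constant cancel between the Stirling bounds and
the harmonic bounds, leaving `log (2 * π * N) / 2 - log 2 - 1 / 2` with `N = k + m`. -/
theorem neg_log_ktWeight_ge (k m : ℕ) :
    (k + m) * (2 * Real.log 2 - 1)
      + Real.posLog (Real.pi * ((k + m : ℕ) : ℝ) / (2 * Real.exp 1)) / 2
      + scoreDeviation k m ≤ -Real.log (ktWeight k m) := by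
  have hlog2 : Real.log 2 ≤ 1 := by linarith [Real.log_two_lt_d9]
  have hpi : Real.pi / (2 * Real.exp 1) ≤ 1 := by
    rw [div_le_one (by positivity)]
    nlinarith [Real.pi_le_four, Real.add_one_le_exp (1 : ℝ)]
  -- For `k + m ≤ 1` the argument of `posLog` is at most `1`; from `2` on it is at least `π / e >
  -- 1`, and `posLog` is a logarithm.
  rcases Nat.lt_or_ge (k + m) 2 with h | h
  · have hz : Real.posLog (Real.pi * ((k + m : ℕ) : ℝ) / (2 * Real.exp 1)) = 0 := by
      rw [Real.posLog_eq_zero_iff, abs_of_nonneg (by positivity), mul_div_right_comm]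
      have : ((k + m : ℕ) : ℝ) ≤ 1 := by exact_mod_cast (by omega : k + m ≤ 1)
      nlinarith [Real.pi_pos, Real.exp_pos 1, show 0 ≤ Real.pi / (2 * Real.exp 1) by positivity]
    rw [hz]
    have : (k = 0 ∧ m = 0) ∨ (k = 1 ∧ m = 0) ∨ (k = 0 ∧ m = 1) := by omega
    rcases this with ⟨rfl, rfl⟩ | ⟨rfl, rfl⟩ | ⟨rfl, rfl⟩ <;>
      simp [scoreDeviation, ktWeight, halfRising, oddHarmonic, harmonic_succ] <;> linarith
  have hN : k + m ≠ 0 := by omega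
  have hN' : (0 : ℝ) < ((k + m : ℕ) : ℝ) := by positivity
  have h1 := log_halfRising_le k
  have h2 := log_halfRising_le m
  have h3 := mul_oddHarmonic_ge k
  have h4 := mul_oddHarmonic_ge m
  have h5 := mul_le_mul_of_nonneg_left (harmonic_le_log_add hN) hN'.le
  have h6 := Stirling.le_log_factorial_stirling hN
  rw [mul_add, show ((k + m : ℕ) : ℝ) * (1 / (2 * ((k + m : ℕ) : ℝ))) = 1 / 2 by field_simp] at h5
  have h7 : Real.posLog (Real.pi * ((k + m : ℕ) : ℝ) / (2 * Real.exp 1))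
      = Real.log (2 * Real.pi * ((k + m : ℕ) : ℝ)) - 2 * Real.log 2 - 1 := by
    have h2N : (2 : ℝ) ≤ ((k + m : ℕ) : ℝ) := by exact_mod_cast h
    rw [Real.posLog_eq_log, show 2 * Real.pi * ((k + m : ℕ) : ℝ)
      = Real.pi * ((k + m : ℕ) : ℝ) / (2 * Real.exp 1) * (2 ^ 2 * Real.exp 1) by
        field_simp, Real.log_mul (x := Real.pi * _ / _) (by positivity) (by positivity),
      Real.log_mul (by positivity) (by positivity), Real.log_pow, Real.log_exp]
    · push_cast; ring
    · rw [abs_of_nonneg (by positivity), one_le_div (by positivity)]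
      nlinarith [Real.pi_gt_three, Real.exp_one_lt_d9]
  rw [h7, ktWeight, Real.log_div (mul_ne_zero (halfRising_pos k).ne' (halfRising_pos m).ne')
    (by positivity), Real.log_mul (halfRising_pos k).ne' (halfRising_pos m).ne', scoreDeviation]
  rw [Real.log_mul (x := 2 * Real.pi) (by positivity) hN'.ne']
  push_cast at h5 h6 ⊢
  linarith

/-! ### Coins with a uniform angle: moments and mean entropy. -/

/-- The probabilities `sin² φ` and `cos² φ` of the two faces of a coin. -/
noncomputable def coin (φ : ℝ) (b : Bool) : ℝ := if b then Real.sin φ ^ 2 else Real.cos φ ^ 2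

theorem coin_nonneg (φ : ℝ) (b : Bool) : 0 ≤ coin φ b := by
  unfold coin; split_ifs <;> positivity

theorem coin_true_add_false (φ : ℝ) : coin φ true + coin φ false = 1 := by
  simp [coin]

theorem continuous_coin (b : Bool) : Continuous fun φ => coin φ b := by
  cases b <;> simp only [coin, ↓reduceIte, Bool.false_eq_true] <;> fun_prop

/-- The uniform distribution on the angles between `0` and `π / 2`. -/
noncomputable def angleMeasure : Measure ℝ :=
  ENNReal.ofReal (2 / Real.pi) • volume.restrict (Set.Ioc 0 (Real.pi / 2))

instance : IsProbabilityMeasure angleMeasure := by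
  constructor
  rw [angleMeasure, Measure.smul_apply, Measure.restrict_apply_univ, Real.volume_Ioc, smul_eq_mul,
    ← ENNReal.ofReal_mul (by positivity)]
  have := Real.pi_pos
  rw [show 2 / Real.pi * (Real.pi / 2 - 0) = 1 by field_simp; ring]
  simp

theorem integral_angleMeasure (f : ℝ → ℝ) :
    ∫ φ, f φ ∂angleMeasure = 2 / Real.pi * ∫ φ in (0 : ℝ)..Real.pi / 2, f φ := by
  rw [angleMeasure, integral_smul_measure, intervalIntegral.integral_of_le (by positivity),
    ENNReal.toReal_ofReal (by positivity), smul_eq_mul]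

theorem integrable_angleMeasure {f : ℝ → ℝ} (hf : Continuous f) : Integrable f angleMeasure :=
  ((hf.integrableOn_Icc (a := 0) (b := Real.pi / 2)).mono_set Set.Ioc_subset_Icc_self).smul_measure
    ENNReal.ofReal_ne_top

/-- Integration by parts: `sin φ ^ (2 * k + 1) * cos φ ^ (2 * m + 1)` vanishes at both ends. -/
theorem integral_coin_pow_succ (k m : ℕ) :
    (2 * k + 1) * ∫ φ, coin φ true ^ k * coin φ false ^ (m + 1) ∂angleMeasure
      = (2 * m + 1) * ∫ φ, coin φ true ^ (k + 1) * coin φ false ^ m ∂angleMeasure := by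
  rw [integral_angleMeasure, integral_angleMeasure]
  have h := intervalIntegral.integral_eq_sub_of_hasDerivAt (a := 0) (b := Real.pi / 2)
    (f := fun φ => Real.sin φ ^ (2 * k + 1) * Real.cos φ ^ (2 * m + 1))
    (f' := fun φ => (2 * k + 1) * (coin φ true ^ k * coin φ false ^ (m + 1))
      - (2 * m + 1) * (coin φ true ^ (k + 1) * coin φ false ^ m)) (fun φ _ => by
        have := ((Real.hasDerivAt_sin φ).pow (2 * k + 1)).mul
          ((Real.hasDerivAt_cos φ).pow (2 * m + 1))
        refine this.congr_deriv ?_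
        simp only [coin, ↓reduceIte, Bool.false_eq_true, Nat.add_sub_cancel, Pi.pow_apply]
        push_cast
        ring)
    (Continuous.intervalIntegrable (by
      have := continuous_coin true
      have := continuous_coin false
      fun_prop) _ _)
  have c1 := continuous_coin true
  have c2 := continuous_coin false
  rw [intervalIntegral.integral_sub (Continuous.intervalIntegrable (by fun_prop) _ _)
    (Continuous.intervalIntegrable (by fun_prop) _ _), intervalIntegral.integral_const_mul,
    intervalIntegral.integral_const_mul] at h
  simp at h
  linear_combination 2 / Real.pi * h

theorem integral_coin_pow_add (k m : ℕ) :
    ∫ φ, coin φ true ^ (k + 1) * coin φ false ^ m ∂angleMeasure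
      + ∫ φ, coin φ true ^ k * coin φ false ^ (m + 1) ∂angleMeasure
      = ∫ φ, coin φ true ^ k * coin φ false ^ m ∂angleMeasure := by
  have c1 := continuous_coin true
  have c2 := continuous_coin false
  rw [← integral_add (integrable_angleMeasure (by fun_prop)) (integrable_angleMeasure (by fun_prop))]
  congr 1 with φ
  linear_combination coin φ true ^ k * coin φ false ^ m * coin_true_add_false φ

/-- A Beta integral. The two preceding relations determine each moment from the moment of total
degree one less, by the recursion of `ktWeight`. -/
theorem integral_coin_pow (k m : ℕ) :
    ∫ φ, coin φ true ^ k * coin φ false ^ m ∂angleMeasure = ktWeight k m := by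
  induction m with
  | zero =>
    induction k with
    | zero => simp [ktWeight]
    | succ k ih =>
      have h1 := integral_coin_pow_add k 0
      have h2 := integral_coin_pow_succ k 0
      rw [ktWeight_succ_left, ← ih, mul_div_assoc', eq_div_iff (by positivity)]
      push_cast at *
      linear_combination (1 / 2) * (2 * k + 1) * h1 - (1 / 2) * h2
  | succ m ih =>
    have h1 := integral_coin_pow_add k m
    have h2 := integral_coin_pow_succ k m
    rw [ktWeight_succ_right, ← ih, mul_div_assoc', eq_div_iff (by positivity)]
    linear_combination (1 / 2) * (2 * m + 1) * h1 + (1 / 2) * h2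

theorem integral_negMulLog_sin_sq :
    ∫ φ in (0 : ℝ)..Real.pi / 2, Real.negMulLog (Real.sin φ ^ 2)
      = Real.log 2 * Real.pi / 2 - Real.pi / 4 := by
  have hg : Continuous fun φ => Real.sin φ * Real.negMulLog (Real.sin φ) := by fun_prop
  have e : ∀ φ, Real.negMulLog (Real.sin φ ^ 2)
      = 2 * (Real.sin φ * Real.negMulLog (Real.sin φ)) := fun φ => by
    rw [sq, Real.negMulLog_mul]; ring
  have hlog : IntervalIntegrable (fun φ => Real.log (Real.sin φ)) volume 0 (Real.pi / 2) :=
    intervalIntegrable_log_sin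
  have hcont : IntervalIntegrable (fun φ => Real.negMulLog (Real.sin φ ^ 2)) volume 0
      (Real.pi / 2) := Continuous.intervalIntegrable (by fun_prop) _ _
  have hcos : IntervalIntegrable (fun φ => Real.cos φ ^ 2) volume 0 (Real.pi / 2) :=
    Continuous.intervalIntegrable (by fun_prop) _ _
  -- The primitive is `cos φ * sin φ * log (sin φ)`, written with `negMulLog` to be continuous at
  -- `0`; it reduces the entropy to the integral of `log (sin φ)`.
  have h := intervalIntegral.integral_eq_sub_of_hasDeriv_right (a := 0) (b := Real.pi / 2)
    (f := fun φ => -(Real.cos φ * Real.negMulLog (Real.sin φ)))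
    (f' := fun φ => Real.log (Real.sin φ) + Real.negMulLog (Real.sin φ ^ 2) + Real.cos φ ^ 2)
    (Continuous.continuousOn (by fun_prop)) (fun φ hφ => by
      rw [min_eq_left (by positivity), max_eq_right (by positivity)] at hφ
      have hs : Real.sin φ ≠ 0 := (Real.sin_pos_of_pos_of_lt_pi hφ.1
        (by linarith [hφ.2, Real.pi_pos])).ne'
      have h1 := (Real.hasDerivAt_negMulLog hs).comp φ (Real.hasDerivAt_sin φ)
      have := ((Real.hasDerivAt_cos φ).mul h1).neg
      refine (this.congr_deriv ?_).hasDerivWithinAt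
      rw [e, Real.negMulLog]
      simp only [Function.comp, Real.negMulLog]
      have := Real.sin_sq_add_cos_sq φ
      linear_combination (Real.log (Real.sin φ)) * this)
    ((hlog.add hcont).add hcos)
  rw [intervalIntegral.integral_add (hlog.add hcont) hcos,
    intervalIntegral.integral_add hlog hcont, integral_log_sin_zero_pi_div_two,
    integral_cos_sq] at h
  simp at h
  linarith

theorem integral_entropy_coin :
    ∫ φ, (Real.negMulLog (coin φ true) + Real.negMulLog (coin φ false)) ∂angleMeasure
      = 2 * Real.log 2 - 1 := by
  rw [integral_angleMeasure]
  simp only [coin, ↓reduceIte, Bool.false_eq_true]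
  rw [intervalIntegral.integral_add (Continuous.intervalIntegrable (by fun_prop) _ _)
    (Continuous.intervalIntegrable (by fun_prop) _ _)]
  have h : ∫ φ in (0 : ℝ)..Real.pi / 2, Real.negMulLog (Real.cos φ ^ 2)
      = ∫ φ in (0 : ℝ)..Real.pi / 2, Real.negMulLog (Real.sin φ ^ 2) := by
    have := intervalIntegral.integral_comp_sub_left (a := 0) (b := Real.pi / 2)
      (fun φ => Real.negMulLog (Real.sin φ ^ 2)) (Real.pi / 2)
    simpa [Real.sin_pi_div_two_sub] using this
  rw [h, integral_negMulLog_sin_sq]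
  have := Real.pi_pos
  field_simp
  ring

/-! ### Tangent-line lower bound on the relative entropy. -/

/-- The convex `klFun` lies above its tangent at `ρ`. Multiplied by the mass of `Q`, this yields a
bound affine in `Q`, with no logarithm of `Q` left to average. -/
theorem klFun_ge_tangent {r ρ : ℝ} (hr : 0 ≤ r) (hρ : 0 ≤ ρ) (h0 : ρ = 0 → r = 0) :
    r * Real.log ρ + 1 - ρ ≤ InformationTheory.klFun r := by
  rw [InformationTheory.klFun]
  rcases hr.eq_or_lt with rfl | hr
  · simp; exact hρ
  have hρ : 0 < ρ := lt_of_le_of_ne hρ fun h => hr.ne' (h0 h.symm)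
  have := Real.log_le_sub_one_of_pos (div_pos hρ hr)
  rw [Real.log_div hρ.ne' hr.ne'] at this
  have := mul_le_mul_of_nonneg_left this hr.le
  rw [mul_sub, mul_sub, mul_div_cancel₀ _ hr.ne'] at this
  linarith

/-- A variational lower bound on the relative entropy, restricted to a finite set of atoms. -/
theorem ofReal_sum_le_klDiv {β : Type*} [MeasurableSpace β] [MeasurableSingletonClass β]
    (P Q : Measure β) [IsProbabilityMeasure P] [IsProbabilityMeasure Q] (S : Finset β)
    (ρ : β → ℝ) (hρ : ∀ x ∈ S, 0 ≤ ρ x) (h0 : ∀ x ∈ S, ρ x = 0 → P.real {x} = 0) :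
    ENNReal.ofReal (∑ x ∈ S, (P.real {x} * Real.log (ρ x) + Q.real {x} * (1 - ρ x)))
      ≤ InformationTheory.klDiv P Q := by
  by_cases hac : P ≪ Q
  swap
  · simp [InformationTheory.klDiv_of_not_ac hac]
  rw [InformationTheory.klDiv_eq_lintegral_klFun_of_ac hac]
  refine le_trans ?_ (setLIntegral_le_lintegral (S : Set β) _)
  rw [lintegral_finset]
  refine le_trans (ENNReal.ofReal_le_ofReal (q := ∑ x ∈ S,
    InformationTheory.klFun (P.rnDeriv Q x).toReal * Q.real {x}) (sum_le_sum fun x hx => ?_)) ?_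
  · have hP : P.real {x} = (P.rnDeriv Q x).toReal * Q.real {x} := by
      have := Measure.setLIntegral_rnDeriv hac {x}
      rw [lintegral_singleton] at this
      rw [Measure.real, ← this, ENNReal.toReal_mul, Measure.real]
    rcases (measureReal_nonneg (μ := Q) (s := {x})).eq_or_lt with hQ | hQ
    · rw [hP, ← hQ]; simp
    have := klFun_ge_tangent (r := (P.rnDeriv Q x).toReal) ENNReal.toReal_nonneg (hρ x hx)
      (fun h => by
        have := h0 x hx h
        rw [hP] at this
        exact (mul_eq_zero.1 this).resolve_right hQ.ne')
    rw [hP]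
    nlinarith
  · rw [ENNReal.ofReal_sum_of_nonneg fun x _ => mul_nonneg
      (InformationTheory.klFun_nonneg ENNReal.toReal_nonneg) measureReal_nonneg]
    refine sum_le_sum fun x _ => ?_
    rw [ENNReal.ofReal_mul (InformationTheory.klFun_nonneg ENNReal.toReal_nonneg),
      ofReal_measureReal]

/-! ### Moments of the letter counts under the mixture. -/

section Urn

variable {ι : Type*} [DecidableEq ι]

/-- The number of occurrences of the letter `(i, b)` in the word `x`. -/
def letterCount {n : ℕ} (x : Fin n → ι × Bool) (i : ι) (b : Bool) : ℕ :=
  #{j | x j = (i, b)}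

theorem letterCount_cons {n : ℕ} (a : ι × Bool) (x : Fin n → ι × Bool) (i : ι) (b : Bool) :
    letterCount (Fin.cons a x : Fin (n + 1) → ι × Bool) i b
      = letterCount x i b + if a = (i, b) then 1 else 0 := by
  simp only [letterCount, card_filter, Fin.sum_univ_succ, Fin.cons_zero, Fin.cons_succ]
  rw [add_comm]

@[simp] theorem letterCount_fin_zero (x : Fin 0 → ι × Bool) (i : ι) (b : Bool) :
    letterCount x i b = 0 := by
  simp [letterCount]

/-- The predictive probability `(k + 1/2) / (k + m + 1)`. -/
noncomputable def ktRatio (k m : ℕ) : ℝ := (k + 1 / 2) / (k + m + 1)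

theorem ktRatio_add (k m : ℕ) : ktRatio k m + ktRatio m k = 1 := by
  unfold ktRatio; field_simp; ring

variable [Fintype ι]

/-- The Krichevsky–Trofimov probability of the second coordinates of a word, given the first. -/
noncomputable def wordKt {n : ℕ} (x : Fin n → ι × Bool) : ℝ :=
  ∏ i, ktWeight (letterCount x i true) (letterCount x i false)

theorem wordKt_pos {n : ℕ} (x : Fin n → ι × Bool) : 0 < wordKt x :=
  prod_pos fun _ _ => ktWeight_pos _ _

theorem wordKt_cons {n : ℕ} (i : ι) (b : Bool) (x : Fin n → ι × Bool) :
    wordKt (Fin.cons (i, b) x : Fin (n + 1) → ι × Bool)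
      = wordKt x * ktRatio (letterCount x i b) (letterCount x i !b) := by
  rw [wordKt, wordKt, Fintype.prod_eq_mul_prod_compl i, Fintype.prod_eq_mul_prod_compl i,
    mul_right_comm]
  congr 1
  · cases b <;> simp [letterCount_cons, ktWeight_succ_left, ktWeight_succ_right, ktRatio, add_comm]
  · refine prod_congr rfl fun j hj => ?_
    have : i ≠ j := by simpa [eq_comm] using hj
    simp [letterCount_cons, this]

/-- The mixture probability of a word. -/
noncomputable def mixtureWeight (q : ι → ℝ) {n : ℕ} (x : Fin n → ι × Bool) : ℝ :=
  (∏ j, q (x j).1) * wordKt x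

/-- The expectation under the mixture of a function of the two counts of the pair `i`. -/
noncomputable def mixtureMean (q : ι → ℝ) (n : ℕ) (i : ι) (g : ℕ → ℕ → ℝ) : ℝ :=
  ∑ x : Fin n → ι × Bool, mixtureWeight q x * g (letterCount x i true) (letterCount x i false)

theorem mixtureMean_add (q : ι → ℝ) (n : ℕ) (i : ι) (g h : ℕ → ℕ → ℝ) :
    mixtureMean q n i (fun k m => g k m + h k m) = mixtureMean q n i g + mixtureMean q n i h := by
  simp only [mixtureMean, mul_add, sum_add_distrib]

theorem mixtureMean_const_mul (q : ι → ℝ) (n : ℕ) (i : ι) (c : ℝ) (g : ℕ → ℕ → ℝ) :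
    mixtureMean q n i (fun k m => c * g k m) = c * mixtureMean q n i g := by
  simp only [mixtureMean, mul_sum]
  exact sum_congr rfl fun _ _ => by ring

theorem mixtureMean_mono {q : ι → ℝ} (hq : ∀ i, 0 ≤ q i) (n : ℕ) (i : ι) {g h : ℕ → ℕ → ℝ}
    (hgh : ∀ k m, g k m ≤ h k m) : mixtureMean q n i g ≤ mixtureMean q n i h :=
  sum_le_sum fun x _ => mul_le_mul_of_nonneg_left (hgh _ _)
    (mul_nonneg (prod_nonneg fun _ _ => hq _) (wordKt_pos x).le)

theorem mixtureMean_zero (q : ι → ℝ) (i : ι) (g : ℕ → ℕ → ℝ) : mixtureMean q 0 i g = g 0 0 := by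
  simp [mixtureMean, mixtureWeight, wordKt, ktWeight]

theorem sum_fin_succ_eq {A : Type*} [Fintype A] {n : ℕ} (F : (Fin (n + 1) → A) → ℝ) :
    ∑ x, F x = ∑ y : Fin n → A, ∑ a, F (Fin.cons a y) := by
  rw [← (Fin.consEquiv fun _ : Fin (n + 1) => A).sum_comp, Fintype.sum_prod_type_right]
  rfl

/-- One step of a Pólya urn: the extra letter belongs to pair `i` with probability `q i`, and its
face then follows the predictive probability `ktRatio`. For the other pairs the two predictive
probabilities sum to one. -/
theorem mixtureMean_succ {q : ι → ℝ} (hq : ∑ i, q i = 1) (n : ℕ) (i : ι) (g : ℕ → ℕ → ℝ) :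
    mixtureMean q (n + 1) i g = mixtureMean q n i fun k m =>
      (1 - q i) * g k m + q i * (ktRatio k m * g (k + 1) m + ktRatio m k * g k (m + 1)) := by
  rw [mixtureMean, mixtureMean, sum_fin_succ_eq]
  refine sum_congr rfl fun x _ => ?_
  simp only [mixtureWeight, Fintype.sum_prod_type, Fintype.sum_bool, wordKt_cons,
    letterCount_cons, Fin.prod_univ_succ, Fin.cons_zero, Fin.cons_succ, Bool.not_true,
    Bool.not_false]
  rw [Fintype.sum_eq_add_sum_compl i]
  have h1 : 1 - q i = ∑ j ∈ ({i} : Finset ι)ᶜ, q j := by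
    rw [← hq, Fintype.sum_eq_add_sum_compl i]; ring
  rw [h1, mul_add, add_comm]
  congr 1
  · rw [sum_mul, mul_sum]
    refine sum_congr rfl fun j hj => ?_
    have : j ≠ i := by simpa using hj
    simp only [Prod.mk.injEq, this, false_and, ↓reduceIte, add_zero]
    linear_combination q j * (∏ l, q (x l).1) * wordKt x *
      g (letterCount x i true) (letterCount x i false) *
      ktRatio_add (letterCount x j true) (letterCount x j false)
  · simp only [Prod.mk.injEq, true_and, Bool.true_eq_false, Bool.false_eq_true, ↓reduceIte,
      add_zero]
    ring

theorem mixtureMean_one {q : ι → ℝ} (hq : ∑ i, q i = 1) (n : ℕ) (i : ι) :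
    mixtureMean q n i (fun _ _ => 1) = 1 := by
  induction n with
  | zero => rw [mixtureMean_zero]
  | succ n ih =>
    rw [mixtureMean_succ hq]
    refine Eq.trans ?_ ih
    congr 1 with k m
    linear_combination q i * ktRatio_add k m

theorem mixtureMean_count {q : ι → ℝ} (hq : ∑ i, q i = 1) (n : ℕ) (i : ι) :
    mixtureMean q n i (fun k m => (k : ℝ) + m) = n * q i := by
  induction n with
  | zero => simp [mixtureMean_zero]
  | succ n ih =>
    have : mixtureMean q (n + 1) i (fun k m => (k : ℝ) + m)
        = mixtureMean q n i (fun k m => ((k : ℝ) + m) + q i * 1) := by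
      rw [mixtureMean_succ hq]
      congr 1 with k m
      push_cast
      linear_combination q i * ((k : ℝ) + m + 1) * ktRatio_add k m
    rw [this, mixtureMean_add, ih, mixtureMean_const_mul, mixtureMean_one hq]
    push_cast; ring

theorem mixtureMean_count_sq {q : ι → ℝ} (hq : ∑ i, q i = 1) (n : ℕ) (i : ι) :
    mixtureMean q n i (fun k m => ((k : ℝ) + m) ^ 2) = (n * q i) ^ 2 + n * q i * (1 - q i) := by
  induction n with
  | zero => simp [mixtureMean_zero]
  | succ n ih =>
    have : mixtureMean q (n + 1) i (fun k m => ((k : ℝ) + m) ^ 2)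
        = mixtureMean q n i
          (fun k m => ((k : ℝ) + m) ^ 2 + (2 * q i * ((k : ℝ) + m) + q i * 1)) := by
      rw [mixtureMean_succ hq]
      congr 1 with k m
      push_cast
      linear_combination q i * ((k : ℝ) + m + 1) ^ 2 * ktRatio_add k m
    rw [this, mixtureMean_add, mixtureMean_add, ih, mixtureMean_const_mul, mixtureMean_const_mul,
      mixtureMean_one hq, mixtureMean_count hq]
    push_cast; ring

/-- The bracket is a martingale along the urn. The weight `c` is arbitrary because the induction
step replaces it by an average of `c N` and `c (N + 1)`. -/
theorem mixtureMean_harmonic_sub {q : ι → ℝ} (hq : ∑ i, q i = 1) (n : ℕ) (i : ι) (c : ℕ → ℝ) :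
    mixtureMean q n i (fun k m => c (k + m) *
      ((harmonic (k + m) : ℝ) - oddHarmonic k / 2 - oddHarmonic m / 2)) = 0 := by
  induction n generalizing c with
  | zero => simp [mixtureMean_zero]
  | succ n ih =>
    rw [mixtureMean_succ hq, ← ih fun N => (1 - q i) * c N + q i * c (N + 1)]
    congr 1 with k m
    rw [show k + 1 + m = k + m + 1 by ring, show k + (m + 1) = k + m + 1 by ring, harmonic_succ,
      oddHarmonic_succ, oddHarmonic_succ, ktRatio, ktRatio]
    push_cast
    field_simp
    ring

/-- `scoreDeviation` is the posterior mean of minus the log-likelihood of the coin, less `N * (2 *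
log 2 - 1)`. A letter of the pair multiplies its conditional mean by `(N + 2) / (N + 1)` and adds a
multiple of the preceding martingale, so an arbitrary weight in `N` makes the induction close. -/
theorem mixtureMean_scoreDeviation_mul {q : ι → ℝ} (hq : ∑ i, q i = 1) (n : ℕ) (i : ι)
    (c : ℕ → ℝ) :
    mixtureMean q n i (fun k m => c (k + m) * scoreDeviation k m) = 0 := by
  induction n generalizing c with
  | zero => simp [mixtureMean_zero, scoreDeviation]
  | succ n ih =>
    have : mixtureMean q (n + 1) i (fun k m => c (k + m) * scoreDeviation k m)
        = mixtureMean q n i (fun k m =>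
          ((1 - q i) * c (k + m) + q i * (c (k + m + 1)
            * ((((k + m : ℕ) : ℝ) + 2) / (((k + m : ℕ) : ℝ) + 1)))) * scoreDeviation k m
          + (q i * c (k + m + 1) / (((k + m : ℕ) : ℝ) + 1)) *
            ((harmonic (k + m) : ℝ) - oddHarmonic k / 2 - oddHarmonic m / 2)) := by
      rw [mixtureMean_succ hq]
      congr 1 with k m
      simp only [scoreDeviation]
      rw [show k + 1 + m = k + m + 1 by ring, show k + (m + 1) = k + m + 1 by ring,
        harmonic_succ, oddHarmonic_succ, oddHarmonic_succ, ktRatio, ktRatio]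
      push_cast
      field_simp
      ring
    rw [this, mixtureMean_add,
      ih fun N => (1 - q i) * c N + q i * (c (N + 1) * (((N : ℝ) + 2) / ((N : ℝ) + 1))),
      mixtureMean_harmonic_sub hq n i fun N => q i * c (N + 1) / ((N : ℝ) + 1), add_zero]

theorem mixtureMean_scoreDeviation {q : ι → ℝ} (hq : ∑ i, q i = 1) (n : ℕ) (i : ι) :
    mixtureMean q n i scoreDeviation = 0 := by
  simpa using mixtureMean_scoreDeviation_mul hq n i fun _ => 1

/-- A one-sided Chebyshev inequality for the number of occurrences of the pair `i`. -/
theorem mixtureMean_posLog_ge {q : ι → ℝ} (hq0 : ∀ i, 0 ≤ q i) (hq : ∑ i, q i = 1) (n : ℕ) (i : ι)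
    (hμ : 0 < n * q i) {lam c : ℝ} (hlam : lam ∈ Set.Ioo (0 : ℝ) 1) (hc : 0 ≤ c) :
    1 / (1 + 1 / (lam ^ 2 * (n * q i))) * Real.posLog (c * ((1 - lam) * (n * q i)))
      ≤ mixtureMean q n i (fun k m => Real.posLog (c * ((k + m : ℕ) : ℝ))) := by
  obtain ⟨hl0, hl1⟩ := hlam
  set μ := n * q i with hμdef
  set T := Real.posLog (c * ((1 - lam) * μ)) with hT
  have hT0 : 0 ≤ T := Real.posLog_nonneg
  -- Cantelli's argument: a parabola in the count bounds the indicator of `(1 - lam) * μ ≤ k + m`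
  -- from below. The shift `1 / lam` is the optimal one for variance `μ`, which bounds the true
  -- variance `μ * (1 - q i)`.
  set d := lam * μ + 1 / lam with hd
  have hd0 : 0 < d := by positivity
  have key : ∀ k m : ℕ, T * (1 - (μ + 1 / lam - ((k : ℝ) + m)) ^ 2 / d ^ 2)
      ≤ Real.posLog (c * ((k + m : ℕ) : ℝ)) := fun k m => by
    rcases le_or_gt ((1 - lam) * μ) ((k + m : ℕ) : ℝ) with h | h
    · refine le_trans (mul_le_of_le_one_right hT0 ?_) (Real.posLog_le_posLog ?_ ?_)
      · have : 0 ≤ (μ + 1 / lam - ((k : ℝ) + m)) ^ 2 / d ^ 2 := by positivity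
        linarith
      · have : 0 ≤ 1 - lam := by linarith
        positivity
      · exact mul_le_mul_of_nonneg_left h hc
    · refine le_trans (mul_nonpos_of_nonneg_of_nonpos hT0 ?_) Real.posLog_nonneg
      rw [sub_nonpos, one_le_div (by positivity)]
      push_cast at h
      exact pow_le_pow_left₀ hd0.le (by rw [hd]; linarith) 2
  refine le_trans ?_ (mixtureMean_mono hq0 n i key)
  have e : mixtureMean q n i
      (fun k m => T * (1 - (μ + 1 / lam - ((k : ℝ) + m)) ^ 2 / d ^ 2))
      = T * (1 - (μ + 1 / lam) ^ 2 / d ^ 2 + 2 * (μ + 1 / lam) / d ^ 2 * μ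
        - (μ ^ 2 + μ * (1 - q i)) / d ^ 2) := by
    have : (fun k m : ℕ => T * (1 - (μ + 1 / lam - ((k : ℝ) + m)) ^ 2 / d ^ 2))
        = fun k m : ℕ => T * (1 - (μ + 1 / lam) ^ 2 / d ^ 2) * 1
          + (T * (2 * (μ + 1 / lam) / d ^ 2) * ((k : ℝ) + m)
            + -(T / d ^ 2) * ((k : ℝ) + m) ^ 2) := by
      ext k m; ring
    rw [this, mixtureMean_add, mixtureMean_add, mixtureMean_const_mul, mixtureMean_const_mul,
      mixtureMean_const_mul, mixtureMean_one hq, mixtureMean_count hq, mixtureMean_count_sq hq]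
    ring
  rw [e, mul_comm]
  refine mul_le_mul_of_nonneg_left ?_ hT0
  have h1 : 1 / (1 + 1 / (lam ^ 2 * μ)) = 1 - (μ + (1 / lam) ^ 2) / d ^ 2 := by
    rw [hd]; field_simp; ring
  have h2 : 1 - (μ + 1 / lam) ^ 2 / d ^ 2 + 2 * (μ + 1 / lam) / d ^ 2 * μ
        - (μ ^ 2 + μ * (1 - q i)) / d ^ 2
      = 1 - (μ + (1 / lam) ^ 2) / d ^ 2 + μ * q i / d ^ 2 := by ring
  rw [h1, h2]
  have := hq0 i
  have : 0 ≤ μ * q i / d ^ 2 := by positivity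
  linarith

end Urn

/-! ### Averaging over independent coins. -/

section Average

variable {ι : Type*}

/-- The probability of the second coordinates of a word, given the first, for the coins `φ`. -/
noncomputable def wordCoin (φ : ι → ℝ) {n : ℕ} (x : Fin n → ι × Bool) : ℝ :=
  ∏ j, coin (φ (x j).1) (x j).2

theorem wordCoin_nonneg (φ : ι → ℝ) {n : ℕ} (x : Fin n → ι × Bool) : 0 ≤ wordCoin φ x :=
  prod_nonneg fun _ _ => coin_nonneg _ _

theorem continuous_wordCoin {n : ℕ} (x : Fin n → ι × Bool) :
    Continuous fun φ : ι → ℝ => wordCoin φ x :=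
  continuous_finsetProd _ fun j _ => (continuous_coin (x j).2).comp (continuous_apply (x j).1)

theorem coin_le_one (φ : ℝ) (b : Bool) : coin φ b ≤ 1 := by
  have := coin_true_add_false φ
  have := coin_nonneg φ true
  have := coin_nonneg φ false
  cases b <;> linarith

theorem wordCoin_le_one (φ : ι → ℝ) {n : ℕ} (x : Fin n → ι × Bool) : wordCoin φ x ≤ 1 :=
  prod_le_one (fun _ _ => coin_nonneg _ _) fun _ _ => coin_le_one _ _

variable [Fintype ι]

/-- The entropy of a product distribution is additive, for a density with respect to weights. -/
theorem sum_prod_mul_negMulLog_prod {A : Type*} [Fintype A] (u v : A → ℝ)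
    (h : ∑ a, u a * v a = 1) (n : ℕ) :
    ∑ x : Fin n → A, (∏ j, u (x j)) * Real.negMulLog (∏ j, v (x j))
      = n * ∑ a, u a * Real.negMulLog (v a) := by
  have hone : ∀ n : ℕ, ∑ x : Fin n → A, (∏ j, u (x j)) * ∏ j, v (x j) = 1 := fun n => by
    simp only [← prod_mul_distrib]
    rw [← Fintype.sum_pow fun a => u a * v a, h, one_pow]
  induction n with
  | zero => simp
  | succ n ih =>
    rw [sum_fin_succ_eq]
    simp only [Fin.prod_univ_succ, Fin.cons_zero, Fin.cons_succ, Real.negMulLog_mul]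
    calc _ = ∑ y : Fin n → A, ((∏ j, u (y j)) * (∏ j, v (y j)) * (∑ a, u a * Real.negMulLog (v a))
          + (∏ j, u (y j)) * Real.negMulLog (∏ j, v (y j)) * ∑ a, u a * v a) := by
          refine sum_congr rfl fun y _ => ?_
          rw [mul_sum, mul_sum, ← sum_add_distrib]
          exact sum_congr rfl fun a _ => by ring
      _ = _ := by
          rw [sum_add_distrib, ← sum_mul, ← sum_mul, hone, ih, h]
          push_cast; ring

theorem integrable_pi_angleMeasure_of_bounded {F : (ι → ℝ) → ℝ} (hF : Continuous F) {C : ℝ}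
    (hC : ∀ φ, |F φ| ≤ C) : Integrable F (Measure.pi fun _ : ι => angleMeasure) :=
  (integrable_const C).mono' hF.aestronglyMeasurable (Eventually.of_forall hC)

theorem abs_negMulLog_le_one {t : ℝ} (h0 : 0 ≤ t) (h1 : t ≤ 1) : |Real.negMulLog t| ≤ 1 := by
  rw [abs_of_nonneg (Real.negMulLog_nonneg h0 h1)]
  rcases h0.eq_or_lt with rfl | h0
  · simp
  have := Real.one_sub_inv_le_log_of_pos h0
  have := mul_le_mul_of_nonneg_left this h0.le
  rw [mul_sub, mul_inv_cancel₀ h0.ne'] at this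
  rw [Real.negMulLog]
  linarith

theorem integrable_wordCoin {n : ℕ} (x : Fin n → ι × Bool) :
    Integrable (fun φ => wordCoin φ x) (Measure.pi fun _ : ι => angleMeasure) :=
  integrable_pi_angleMeasure_of_bounded (continuous_wordCoin x) (C := 1) fun φ => by
    rw [abs_of_nonneg (wordCoin_nonneg φ x)]; exact wordCoin_le_one φ x

theorem integrable_negMulLog_wordCoin {n : ℕ} (x : Fin n → ι × Bool) :
    Integrable (fun φ => Real.negMulLog (wordCoin φ x)) (Measure.pi fun _ : ι => angleMeasure) :=
  integrable_pi_angleMeasure_of_bounded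
    (Real.continuous_negMulLog.comp (continuous_wordCoin x)) (C := 1)
    fun φ => abs_negMulLog_le_one (wordCoin_nonneg φ x) (wordCoin_le_one φ x)

/-- Entropy is additive over the letters, and all coins have the same mean entropy, so `q`
disappears from the result. -/
theorem integral_sum_negMulLog_wordCoin {q : ι → ℝ} (hq : ∑ i, q i = 1) (n : ℕ) :
    ∑ x : Fin n → ι × Bool, (∏ j, q (x j).1) *
      ∫ φ, Real.negMulLog (wordCoin φ x) ∂(Measure.pi fun _ : ι => angleMeasure)
      = n * (2 * Real.log 2 - 1) := by
  simp only [← integral_const_mul]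
  rw [← integral_finsetSum _ fun x _ => (integrable_negMulLog_wordCoin x).const_mul _]
  have h : ∀ φ : ι → ℝ, ∑ x : Fin n → ι × Bool, (∏ j, q (x j).1) * Real.negMulLog (wordCoin φ x)
      = n * ∑ i, q i * (Real.negMulLog (coin (φ i) true) + Real.negMulLog (coin (φ i) false)) :=
    fun φ => by
      have := sum_prod_mul_negMulLog_prod (fun a : ι × Bool => q a.1)
        (fun a => coin (φ a.1) a.2) (by
          simp only [Fintype.sum_prod_type, Fintype.sum_bool, ← mul_add, coin_true_add_false,
            mul_one, hq]) n
      simpa [Fintype.sum_prod_type, ← mul_add, wordCoin] using this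
  have c1 := continuous_coin true
  have c2 := continuous_coin false
  have hc : Continuous fun t => Real.negMulLog (coin t true) + Real.negMulLog (coin t false) := by
    fun_prop
  have hi : ∀ i : ι, Integrable (fun φ : ι → ℝ => Real.negMulLog (coin (φ i) true)
      + Real.negMulLog (coin (φ i) false)) (Measure.pi fun _ : ι => angleMeasure) := fun i =>
    integrable_pi_angleMeasure_of_bounded (hc.comp (continuous_apply i)) (C := 1 + 1) fun φ =>
      (abs_add_le _ _).trans (add_le_add (abs_negMulLog_le_one (coin_nonneg _ _) (coin_le_one _ _))
        (abs_negMulLog_le_one (coin_nonneg _ _) (coin_le_one _ _)))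
  simp only [h]
  rw [integral_const_mul, integral_finsetSum _ fun i _ => (hi i).const_mul _]
  congr 1
  simp only [integral_const_mul]
  rw [sum_congr rfl fun i _ => by
    rw [integral_comp_eval (μ := fun _ : ι => angleMeasure) (i := i)
      (f := fun t => Real.negMulLog (coin t true) + Real.negMulLog (coin t false))
      hc.aestronglyMeasurable, integral_entropy_coin], ← sum_mul, hq, one_mul]

variable [DecidableEq ι]

theorem wordCoin_eq_prod (φ : ι → ℝ) {n : ℕ} (x : Fin n → ι × Bool) :
    wordCoin φ x = ∏ i, coin (φ i) true ^ letterCount x i true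
      * coin (φ i) false ^ letterCount x i false := by
  have h : wordCoin φ x = ∏ a : ι × Bool, coin (φ a.1) a.2 ^ letterCount x a.1 a.2 := by
    rw [wordCoin, ← Finset.prod_fiberwise univ x]
    refine prod_congr rfl fun a _ => ?_
    rw [letterCount, ← prod_const]
    refine prod_congr rfl fun j hj => ?_
    rw [(mem_filter.1 hj).2]
  rw [h, Fintype.prod_prod_type]
  simp

theorem integral_wordCoin {n : ℕ} (x : Fin n → ι × Bool) :
    ∫ φ, wordCoin φ x ∂(Measure.pi fun _ : ι => angleMeasure) = wordKt x := by
  simp only [wordCoin_eq_prod, wordKt, ← integral_coin_pow]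
  exact integral_fintype_prod_eq_prod (μ := fun _ : ι => angleMeasure) fun i φ =>
    coin φ true ^ letterCount x i true * coin φ false ^ letterCount x i false

theorem mixtureMean_neg_log_ktWeight_ge {q : ι → ℝ} (hq0 : ∀ i, 0 ≤ q i) (hq : ∑ i, q i = 1)
    (n : ℕ) (i : ι) :
    n * q i * (2 * Real.log 2 - 1)
      + mixtureMean q n i (fun k m =>
        Real.posLog (Real.pi / (2 * Real.exp 1) * ((k + m : ℕ) : ℝ))) / 2
      ≤ mixtureMean q n i (fun k m => -Real.log (ktWeight k m)) := by
  have h := mixtureMean_mono hq0 n i neg_log_ktWeight_ge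
  refine le_trans (le_of_eq ?_) h
  rw [mixtureMean_add, mixtureMean_scoreDeviation hq, add_zero]
  have : (fun k m : ℕ => ((k : ℝ) + m) * (2 * Real.log 2 - 1)
      + Real.posLog (Real.pi * ((k + m : ℕ) : ℝ) / (2 * Real.exp 1)) / 2)
      = fun k m : ℕ => (2 * Real.log 2 - 1) * ((k : ℝ) + m)
      + 1 / 2 * Real.posLog (Real.pi / (2 * Real.exp 1) * ((k + m : ℕ) : ℝ)) := by
    ext k m
    rw [mul_div_right_comm]; ring
  rw [this, mixtureMean_add, mixtureMean_const_mul, mixtureMean_const_mul, mixtureMean_count hq]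
  ring

theorem sum_mixtureWeight_mul_log_wordKt (q : ι → ℝ) (n : ℕ) :
    ∑ x : Fin n → ι × Bool, mixtureWeight q x * -Real.log (wordKt x)
      = ∑ i, mixtureMean q n i (fun k m => -Real.log (ktWeight k m)) := by
  simp only [mixtureMean]
  rw [sum_comm]
  refine sum_congr rfl fun x _ => ?_
  rw [wordKt, Real.log_prod fun i _ => (ktWeight_pos _ _).ne', ← sum_neg_distrib, mul_sum]

/-- Some choice of the coins is at least as hard for the coding distribution `Q` as the average. -/
theorem exists_coins_sum_ge {q : ι → ℝ} (hq0 : ∀ i, 0 ≤ q i) (hq : ∑ i, q i = 1)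
    (n : ℕ) (Q : (Fin n → ι × Bool) → ℝ) :
    ∃ φ : ι → ℝ, ∑ i, mixtureMean q n i (fun k m =>
        Real.posLog (Real.pi / (2 * Real.exp 1) * ((k + m : ℕ) : ℝ))) / 2
      ≤ ∑ x : Fin n → ι × Bool, ((∏ j, q (x j).1) * wordCoin φ x *
          Real.log (wordCoin φ x / wordKt x) + Q x * (1 - wordCoin φ x / wordKt x)) := by
  have e : ∀ (φ : ι → ℝ) (x : Fin n → ι × Bool),
      (∏ j, q (x j).1) * wordCoin φ x * Real.log (wordCoin φ x / wordKt x)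
        + Q x * (1 - wordCoin φ x / wordKt x)
      = -((∏ j, q (x j).1) * Real.negMulLog (wordCoin φ x))
        + ((∏ j, q (x j).1) * -Real.log (wordKt x) - Q x / wordKt x) * wordCoin φ x + Q x :=
    fun φ x => by
      rcases eq_or_ne (wordCoin φ x) 0 with h | h
      · simp [h]
      rw [Real.log_div h (wordKt_pos x).ne', Real.negMulLog]
      ring
  simp only [e]
  have hint : ∀ x : Fin n → ι × Bool, Integrable (fun φ : ι → ℝ =>
      -((∏ j, q (x j).1) * Real.negMulLog (wordCoin φ x))
        + ((∏ j, q (x j).1) * -Real.log (wordKt x) - Q x / wordKt x) * wordCoin φ x + Q x)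
      (Measure.pi fun _ : ι => angleMeasure) := fun x =>
    ((((integrable_negMulLog_wordCoin x).const_mul _).neg).add
      ((integrable_wordCoin x).const_mul _)).add (integrable_const _)
  obtain ⟨φ, hφ⟩ := exists_integral_le (integrable_finsetSum univ fun x _ => hint x)
  refine ⟨φ, le_trans ?_ hφ⟩
  rw [integral_finsetSum _ fun x _ => hint x]
  -- The terms in `Q x` cancel: `wordCoin φ x / wordKt x` has mean one over `φ`.
  have hx : ∀ x : Fin n → ι × Bool, ∫ φ : ι → ℝ,
      (-((∏ j, q (x j).1) * Real.negMulLog (wordCoin φ x))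
        + ((∏ j, q (x j).1) * -Real.log (wordKt x) - Q x / wordKt x) * wordCoin φ x + Q x)
      ∂(Measure.pi fun _ : ι => angleMeasure)
      = mixtureWeight q x * -Real.log (wordKt x) - (∏ j, q (x j).1) *
        ∫ φ, Real.negMulLog (wordCoin φ x) ∂(Measure.pi fun _ : ι => angleMeasure) := fun x => by
    have i1 : Integrable (fun φ : ι → ℝ => -((∏ j, q (x j).1) * Real.negMulLog (wordCoin φ x)))
      (Measure.pi fun _ : ι => angleMeasure) :=
      ((integrable_negMulLog_wordCoin x).const_mul (∏ j, q (x j).1)).neg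
    have i2 := (integrable_wordCoin x).const_mul
      ((∏ j, q (x j).1) * -Real.log (wordKt x) - Q x / wordKt x)
    rw [integral_add (by exact i1.add i2) (integrable_const _), integral_add i1 i2,
      integral_neg, integral_const_mul, integral_const_mul, integral_wordCoin, integral_const,
      mixtureWeight]
    have := (wordKt_pos x).ne'
    simp only [probReal_univ, one_smul]
    field_simp
    ring
  rw [sum_congr rfl fun x _ => hx x, sum_sub_distrib, integral_sum_negMulLog_wordCoin hq,
    sum_mixtureWeight_mul_log_wordKt]
  have := sum_le_sum fun i (_ : i ∈ univ) => mixtureMean_neg_log_ktWeight_ge hq0 hq n i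
  rw [sum_add_distrib, ← sum_mul, ← mul_sum, hq, mul_one] at this
  linarith

end Average

theorem ofReal_sum_le_klDiv_of_injective {β γ : Type*} [MeasurableSpace β]
    [MeasurableSingletonClass β] [Fintype γ] (P Q : Measure β) [IsProbabilityMeasure P]
    [IsProbabilityMeasure Q] {E : γ → β} (hE : Function.Injective E) (ρ : γ → ℝ)
    (hρ : ∀ x, 0 ≤ ρ x) (h0 : ∀ x, ρ x = 0 → P.real {E x} = 0) :
    ENNReal.ofReal (∑ x, (P.real {E x} * Real.log (ρ x) + Q.real {E x} * (1 - ρ x)))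
      ≤ InformationTheory.klDiv P Q := by
  have h := ofReal_sum_le_klDiv P Q (univ.map ⟨E, hE⟩) (Function.extend E ρ 0)
    (by simpa [hE.extend_apply] using hρ) (by simpa [hE.extend_apply] using h0)
  simpa [hE.extend_apply] using h

/-! ### Memoryless sources with a finitely supported marginal. -/

section IidSource

variable {α : Type*} [MeasurableSpace α] (ν : Measure α) [IsProbabilityMeasure ν]

/-- The stationary memoryless source with the given first marginal. -/
noncomputable def iidSource : Source α := ⟨Measure.infinitePi fun _ => ν, inferInstance⟩

theorem iidSource_isMemoryless : (iidSource ν).IsMemoryless :=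
  iIndepFun_infinitePi (P := fun _ : ℕ => ν) (X := fun _ ω => ω) fun _ => measurable_id

/-- The shift and the restriction to the first `n` symbols are both reindexings along an injective
map. -/
theorem iidSource_map_comp {κ : Type*} {g : κ → ℕ} (hg : Function.Injective g) :
    ((iidSource ν : Source α) : Measure (ℕ → α)).map (fun x k => x (g k))
      = Measure.infinitePi fun _ : κ => ν := by
  have h := (iidSource_isMemoryless ν).precomp hg
  rw [iIndepFun_iff_map_fun_eq_infinitePi_map (by fun_prop)] at h
  refine h.trans ?_
  congr 1
  ext1 k
  exact Measure.infinitePi_map_eval (fun _ : ℕ => ν) (g k)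

theorem iidSource_isStationary : (iidSource ν).IsStationary :=
  ⟨by fun_prop, iidSource_map_comp ν (add_left_injective 1)⟩

theorem iidSource_marginal : (iidSource ν).marginal = ν :=
  Measure.infinitePi_map_eval (fun _ : ℕ => ν) 0

theorem iidSource_block_real_singleton [MeasurableSingletonClass α] (n : ℕ) (x : Fin n → α) :
    ((iidSource ν).block n : Measure (Fin n → α)).real {x} = ∏ j, ν.real {x j} := by
  have h : ((iidSource ν).block n : Measure (Fin n → α)) = Measure.infinitePi fun _ => ν :=
    iidSource_map_comp ν Fin.val_injective
  rw [h, Measure.real, Measure.infinitePi_singleton_of_fintype, ENNReal.toReal_prod]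
  rfl

theorem iidSource_hasFiniteEntropy [MeasurableSingletonClass α] (S : Finset α)
    (hS : ∀ a ∉ S, ν.real {a} = 0) : (iidSource ν).HasFiniteEntropy := fun n => by
  classical
  refine summable_of_ne_finset_zero (s := Fintype.piFinset fun _ => S) fun x hx => ?_
  obtain ⟨j, hj⟩ : ∃ j, x j ∉ S := by simpa using hx
  rw [iidSource_block_real_singleton, prod_eq_zero (mem_univ j) (hS _ hj), Real.negMulLog_zero]

end IidSource

section FiniteLaw

variable {α A : Type*} [MeasurableSpace α] [Fintype A]

/-- The discrete measure with weights `w a` at the points `e a`. -/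
noncomputable def finiteLaw (e : A → α) (w : A → ℝ) : Measure α :=
  ∑ a, ENNReal.ofReal (w a) • Measure.dirac (e a)

theorem isProbabilityMeasure_finiteLaw (e : A → α) {w : A → ℝ} (hw : ∀ a, 0 ≤ w a)
    (hw1 : ∑ a, w a = 1) : IsProbabilityMeasure (finiteLaw e w) := by
  constructor
  simp [finiteLaw, Measure.finsetSum_apply, ← ENNReal.ofReal_sum_of_nonneg fun a _ => hw a, hw1]

variable [MeasurableSingletonClass α]

theorem finiteLaw_real_singleton {e : A → α} (he : Function.Injective e) {w : A → ℝ}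
    (hw : ∀ a, 0 ≤ w a) (a : A) : (finiteLaw e w).real {e a} = w a := by
  classical
  simp [Measure.real, finiteLaw, Measure.finsetSum_apply, Set.indicator, he.eq_iff, hw a]

theorem finiteLaw_real_singleton_of_notMem (e : A → α) (w : A → ℝ) {y : α}
    (hy : y ∉ Set.range e) : (finiteLaw e w).real {y} = 0 := by
  have : ∀ a, e a ≠ y := fun a h => hy ⟨a, h⟩
  simp [Measure.real, finiteLaw, Measure.finsetSum_apply, Set.indicator, this]

end FiniteLaw

/-! ### Embedding the pairs into the envelope class. -/

section Envelope

variable {ι : Type*} [Fintype ι] [DecidableEq ι]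

theorem sum_mixtureMean_le_maxRedundancy {f : ℕ+ → ℝ} (hf : ∀ k, 0 ≤ f k) {q : ι → ℝ}
    (hq0 : ∀ i, 0 ≤ q i) (hq : ∑ i, q i = 1) {e : ι × Bool → ℕ+} (he : Function.Injective e)
    (hqf : ∀ a, q a.1 ≤ f (e a)) (n : ℕ) (Q : ProbabilityMeasure (Fin n → ℕ+)) :
    ENNReal.ofReal ((∑ i, mixtureMean q n i (fun k m =>
        Real.posLog (Real.pi / (2 * Real.exp 1) * ((k + m : ℕ) : ℝ))) / 2) / Real.log 2)
      ≤ maxRedundancy (envelopeClass f) n Q := by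
  obtain ⟨φ, hφ⟩ := exists_coins_sum_ge hq0 hq n
    (fun x => (Q : Measure (Fin n → ℕ+)).real {fun j => e (x j)})
  set w : ι × Bool → ℝ := fun a => q a.1 * coin (φ a.1) a.2 with hwdef
  have hw : ∀ a, 0 ≤ w a := fun a => mul_nonneg (hq0 _) (coin_nonneg _ _)
  have hw1 : ∑ a, w a = 1 := by
    simp only [hwdef, Fintype.sum_prod_type, Fintype.sum_bool, ← mul_add, coin_true_add_false,
      mul_one, hq]
  have := isProbabilityMeasure_finiteLaw e hw hw1
  set P := iidSource (finiteLaw e w) with hP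
  have hPmem : P ∈ envelopeClass f := by
    refine ⟨iidSource_isStationary _, iidSource_isMemoryless _,
      iidSource_hasFiniteEntropy _ (univ.image e) fun y hy =>
        finiteLaw_real_singleton_of_notMem e w (by simpa using hy), fun y => ?_⟩
    rw [iidSource_marginal]
    by_cases hy : y ∈ Set.range e
    · obtain ⟨a, rfl⟩ := hy
      rw [finiteLaw_real_singleton he hw]
      exact (mul_le_of_le_one_right (hq0 _) (coin_le_one _ _)).trans (hqf a)
    · rw [finiteLaw_real_singleton_of_notMem e w hy]
      exact hf y
  have hE : Function.Injective fun (x : Fin n → ι × Bool) (j : Fin n) => e (x j) :=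
    fun x y h => funext fun j => he (congrFun h j)
  have hPx : ∀ x : Fin n → ι × Bool, (P.block n : Measure (Fin n → ℕ+)).real {fun j => e (x j)}
      = (∏ j, q (x j).1) * wordCoin φ x := fun x => by
    rw [hP, iidSource_block_real_singleton, wordCoin, ← prod_mul_distrib]
    exact prod_congr rfl fun j _ => finiteLaw_real_singleton he hw _
  have hkl := ofReal_sum_le_klDiv_of_injective (P.block n : Measure (Fin n → ℕ+))
    (Q : Measure (Fin n → ℕ+)) hE (fun x => wordCoin φ x / wordKt x)
    (fun x => div_nonneg (wordCoin_nonneg φ x) (wordKt_pos x).le) (fun x hx => by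
      rw [hPx, (div_eq_zero_iff.1 hx).resolve_right (wordKt_pos x).ne', mul_zero])
  simp only [hPx] at hkl
  rw [ENNReal.ofReal_div_of_pos (Real.log_pos one_lt_two)]
  refine le_trans ?_ (le_iSup₂ (f := fun P _ => klDivBits (Source.block P n) Q) P hPmem)
  exact ENNReal.div_le_div_right ((ENNReal.ofReal_le_ofReal hφ).trans hkl) _

end Envelope

/-- The two letters `2 i` and `2 i - 1` of the pair `i`. -/
def pairLetter {s : Finset ℕ+} (a : s × Bool) : ℕ+ :=
  if a.2 then 2 * (a.1 : ℕ+)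
  else ⟨2 * ((a.1 : ℕ+) : ℕ) - 1, by have := (a.1 : ℕ+).pos; omega⟩

theorem pairLetter_injective {s : Finset ℕ+} :
    Function.Injective (pairLetter : s × Bool → ℕ+) := by
  rintro ⟨⟨i, hi⟩, b⟩ ⟨⟨j, hj⟩, b'⟩ h
  have h := congrArg (fun k : ℕ+ => (k : ℕ)) h
  have := i.pos
  have := j.pos
  cases b <;> cases b' <;> simp [pairLetter] at h ⊢ <;>
    first
      | omega
      | exact PNat.eq (by omega)

theorem pairLetter_le {s : Finset ℕ+} (a : s × Bool) : pairLetter a ≤ 2 * (a.1 : ℕ+) := by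
  obtain ⟨i, b⟩ := a
  cases b
  · rw [← PNat.coe_le_coe]
    simp [pairLetter]
  · simp [pairLetter]

end Auxiliary

/-! ### The theorem: choice of `q` and comparison of constants. -/

theorem mainTheorem2 (f : ℕ+ → ℝ) (hf01 : ∀ k, f k ∈ Set.Icc (0 : ℝ) 1)
    (hf_anti : Antitone f) (hf_sum : Summable f)
    (p : ℕ+) (hp : 1 < evenSum f p) (hfp : 0 < f (2 * p))
    (n : ℕ+) (ε lam : ℝ) (hε : 0 < ε) (hlam : lam ∈ Set.Ioo (0 : ℝ) 1)
    (hn : evenSum f p / f (2 * p) * (10 / (ε * (1 - lam))) < (n : ℝ)) :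
    ((1 / (1 + evenSum f p / (lam ^ 2 * n * f (2 * p)))
          * (1 - 4 / Real.pi * Real.sqrt (5 * evenSum f p / ((1 - lam) * ε * n * f (2 * p))))
          * ∑ i ∈ Finset.Icc 1 p,
              (1 / 2 * Real.logb 2
                (n * (1 - lam) * Real.pi * f (2 * i) / (2 * evenSum f p * Real.exp 1)) - ε) :
        ℝ) : EReal)
      ≤ (minimaxRedundancy (envelopeClass f) n : EReal) := by
  set c := evenSum f p with hc
  have hc0 : 0 < c := by linarith
  have hn0 : (0 : ℝ) < n := by exact_mod_cast n.pos
  obtain ⟨hl0, hl1⟩ := hlam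
  have hl : 0 < 1 - lam := by linarith
  have hlog2 : 0 < Real.log 2 := Real.log_pos one_lt_two
  have hfle : ∀ i : Finset.Icc 1 p, f (2 * p) ≤ f (2 * (i : ℕ+)) := fun i =>
    hf_anti (mul_le_mul_right (Finset.mem_Icc.1 i.2).2 2)
  set q : Finset.Icc 1 p → ℝ := fun i => f (2 * (i : ℕ+)) / c with hqdef
  have hqpos : ∀ i, 0 < q i := fun i => div_pos (hfp.trans_le (hfle i)) hc0
  have hq : ∑ i, q i = 1 := by
    rw [← Finset.sum_div, div_eq_one_iff_eq hc0.ne', hc, evenSum]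
    exact Finset.sum_coe_sort (Finset.Icc 1 p) fun k => f (2 * k)
  set A := 1 / (1 + c / (lam ^ 2 * n * f (2 * p))) with hA
  set D := 1 - 4 / Real.pi * Real.sqrt (5 * c / ((1 - lam) * ε * n * f (2 * p))) with hD
  have hA0 : 0 ≤ A := by positivity
  have hD1 : D ≤ 1 := sub_le_self _ (by positivity)
  -- The bound on `n` makes the radicand less than `1 / 2 < (3 / 4) ^ 2`, and `π > 3`.
  have hD0 : 0 ≤ D := by
    have h1 : 5 * c / ((1 - lam) * ε * n * f (2 * p)) ≤ (3 / 4) ^ 2 := by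
      rw [div_mul_div_comm, div_lt_iff₀ (by positivity)] at hn
      rw [div_le_iff₀ (by positivity)]
      nlinarith
    have h2 := Real.sqrt_le_sqrt h1
    rw [Real.sqrt_sq (by norm_num)] at h2
    have h3 : 4 / Real.pi * Real.sqrt (5 * c / ((1 - lam) * ε * n * f (2 * p)))
        ≤ 4 / 3 * (3 / 4) :=
      mul_le_mul (div_le_div_of_nonneg_left (by norm_num) (by norm_num) Real.pi_gt_three.le) h2
        (Real.sqrt_nonneg _) (by norm_num)
    rw [hD]
    linarith
  refine le_trans (EReal.coe_le_coe_iff.2 ?_ : _ ≤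
    (((∑ i, mixtureMean q n i (fun k m =>
        Real.posLog (Real.pi / (2 * Real.exp 1) * ((k + m : ℕ) : ℝ))) / 2) / Real.log 2 : ℝ)
      : EReal)) ?_
  · rw [← Finset.sum_coe_sort, Finset.mul_sum, Finset.sum_div]
    refine Finset.sum_le_sum fun i _ => ?_
    have hμ : 0 < n * q i := mul_pos hn0 (hqpos i)
    have hch := mixtureMean_posLog_ge (fun i => (hqpos i).le) hq n i hμ ⟨hl0, hl1⟩
      (show 0 ≤ Real.pi / (2 * Real.exp 1) by positivity)
    have hY : n * (1 - lam) * Real.pi * f (2 * (i : ℕ+)) / (2 * c * Real.exp 1)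
        = Real.pi / (2 * Real.exp 1) * ((1 - lam) * (n * q i)) := by
      simp only [hqdef]; field_simp
    rw [hY]
    set Y := Real.pi / (2 * Real.exp 1) * ((1 - lam) * (n * q i)) with hYdef
    have hAi : A ≤ 1 / (1 + 1 / (lam ^ 2 * (n * q i))) := by
      refine one_div_le_one_div_of_le (by positivity) (add_le_add_right ?_ 1)
      have : 1 / (lam ^ 2 * (n * q i)) = c / (lam ^ 2 * n * f (2 * (i : ℕ+))) := by
        simp only [hqdef]; field_simp
      rw [this]
      exact div_le_div_of_nonneg_left hc0.le (by positivity)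
        (mul_le_mul_of_nonneg_left (hfle i) (by positivity))
    have hpl : Real.log Y ≤ Real.posLog Y := le_max_right _ _
    have hpl0 : 0 ≤ Real.posLog Y := Real.posLog_nonneg
    -- A summant with `Y` small may be negative; replacing `log` by `posLog` first makes it
    -- legitimate to drop `D ≤ 1` and enlarge `A`.
    calc A * D * (1 / 2 * Real.logb 2 Y - ε)
        ≤ A * D * (Real.posLog Y / 2 / Real.log 2) := by
          refine mul_le_mul_of_nonneg_left ?_ (mul_nonneg hA0 hD0)
          have : 1 / 2 * Real.logb 2 Y = Real.log Y / 2 / Real.log 2 := by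
            rw [Real.logb]; ring
          rw [this]
          have : Real.log Y / 2 / Real.log 2 ≤ Real.posLog Y / 2 / Real.log 2 := by gcongr
          linarith
      _ ≤ A * (Real.posLog Y / 2 / Real.log 2) :=
          mul_le_mul_of_nonneg_right (mul_le_of_le_one_right hA0 hD1) (by positivity)
      _ ≤ 1 / (1 + 1 / (lam ^ 2 * (n * q i))) * (Real.posLog Y / 2 / Real.log 2) :=
          mul_le_mul_of_nonneg_right hAi (by positivity)
      _ = 1 / (1 + 1 / (lam ^ 2 * (n * q i))) * Real.posLog Y / 2 / Real.log 2 := by ring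
      _ ≤ _ := by gcongr
  · have hmin := le_iInf fun Q : ProbabilityMeasure (Fin n → ℕ+) =>
      sum_mixtureMean_le_maxRedundancy (fun k => (hf01 k).1) (fun i => (hqpos i).le) hq
        pairLetter_injective (fun a => (div_le_self (hf01 _).1 hp.le).trans
          (hf_anti (pairLetter_le a))) n Q
    refine le_trans ?_ (EReal.coe_ennreal_le_coe_ennreal_iff.2 hmin)
    rw [EReal.coe_ennreal_ofReal]
    exact EReal.coe_le_coe_iff.2 (le_max_left _ _)
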